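/- All colorings are proper vertex colorings. A $k$-coloring of a graph $G$ is a map $c:V(G)\to S$ with $|S|=k$ and $c(u)\neq c(v)$ whenever $u,v$ are adjacent. A vertex $v$ is dominant in $c$ if for every color $i\in S\setminus\{c(v)\}$ it has a neighbor of color $i$. The $b$-chromatic number $b(G)$ is the largest integer $k$ such that $G$ has a $k$-coloring in which every color is the color of some dominant vertex. For a $d$-regular graph $G$, the $f$-chromatic vertex number $f(G)$ is the maximum number of dominant vertices with pairwise distinct colors in a $(d+1)$-coloring of $G$. **Theorem 3.1.** Let $G$ be a $d$-regular graph with $d\geq 7$, girth $5$ and diameter $5$. Then $$f(G)\geq\left\lceil\frac{d-1}{2}\right\rceil+4\qquad\text{and}\qquad b(G)\geq\left\lceil\frac{d-1}{2}\right\rceil+4.$$ -/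

import Mathlib

namespace SimpleGraph

variable {V : Type*} {α : Type*} (G : SimpleGraph V)

/-- In a proper coloring `c` with set of colors `α`, the vertex `v` is dominant if it has a
neighbor in each color class distinct from its own. -/
def IsDominant {G : SimpleGraph V} (c : G.Coloring α) (v : V) : Prop :=
  ∀ i : α, i ≠ c v → ∃ w, G.Adj v w ∧ c w = i

/-- A proper coloring is a `b`-coloring if each color class contains a dominant vertex
(in particular, every color is used). -/
def IsBColoring {G : SimpleGraph V} (c : G.Coloring α) : Prop :=
  ∀ i : α, ∃ v, c v = i ∧ IsDominant c v

/-- The `b`-chromatic number `b(G)`: the largest `k` such that `G` has a `b`-coloring with `k`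
colors. (The values of `k` with this property are at most `d + 1` if `G` is `d`-regular.) -/
noncomputable def bChromaticNumber : ℕ :=
  sSup {k | ∃ c : G.Coloring (Fin k), IsBColoring c}

/-- The `f`-chromatic vertex number `f(G)` of a `d`-regular graph `G`: the maximum number of
dominant vertices of pairwise distinct colors in a proper coloring of `G` with `d + 1` colors.
(Such a number is at most `d + 1`, the number of colors.) -/
noncomputable def fChromaticVertexNumber (d : ℕ) : ℕ :=
  sSup {n | ∃ (c : G.Coloring (Fin (d + 1))) (S : Finset V),
    (∀ v ∈ S, IsDominant c v) ∧ Set.InjOn c (S : Set V) ∧ S.card = n}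

end SimpleGraph

/-! Take `x` and `y` at distance 5. For the `2 * d` vertices `u` adjacent to one of them, the sets
`S u` of remaining neighbors have size `n = d - 1`, are pairwise disjoint, and have at most a
matching between any two, as there are no short cycles. A vertex is dominant once its closed
neighborhood is rainbow. So it suffices to make the balls around `x` and `y` rainbow, with distinct
colors on `x`, `y` and `d / 2 + 2` of the vertices `u`, to color the `S u` of these `u` compatibly,
and to finish greedily (`exists_coloring_dominant`).

The sets `S u` are colored one at a time by Hall's theorem. An obstruction consists of vertices `B`
and colors `A`, all pairs blocked, with `#A + #B > n`; both sizes are at most the number of sets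
already colored (`extend_or_obstruction`). This alone handles `n / 2 + 1` sets. A last set is gained
by double counting: some choice of the earlier sets has too few edges to the last one for an
obstruction. For odd `n` one more set is needed, gained by recoloring one vertex
(`exists_isRainbowOn_of_odd`).

For `b(G)`, colors without a dominant vertex are eliminated (`exists_isBColoring`). -/

namespace SimpleGraph

open Finset

/-! ### Hall's condition -/

/-- Hall's theorem for a relation of forbidden pairs. -/
theorem exists_injOn_avoiding {V α : Type*} [Nonempty α] (s : Finset V) (t : Finset α)
    (F : V → α → Prop) (hst : #s ≤ #t)
    (h : ∀ B ⊆ s, ∀ A ⊆ t, B.Nonempty → A.Nonempty → (∀ b ∈ B, ∀ a ∈ A, F b a) →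
      #A + #B ≤ #t) :
    ∃ f : V → α, Set.InjOn f s ∧ (∀ z ∈ s, f z ∈ t) ∧ ∀ z ∈ s, ¬ F z (f z) := by
  classical
  have hall : ∀ B : Finset s, #B ≤ #(B.biUnion fun z => {a ∈ t | ¬ F z a}) := by
    intro B
    rcases B.eq_empty_or_nonempty with rfl | hB
    · simp
    set N := B.biUnion fun z => {a ∈ t | ¬ F z a} with hN
    have hNt : N ⊆ t := biUnion_subset.2 fun z _ => filter_subset _ _
    have hBs : B.map (Function.Embedding.subtype _) ⊆ s := by
      intro z hz
      obtain ⟨b, -, rfl⟩ := mem_map.1 hz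
      exact b.2
    have hcard := card_sdiff_add_card_eq_card hNt
    rcases (t \ N).eq_empty_or_nonempty with hA | hA
    · rw [hA, card_empty, zero_add] at hcard
      have := card_le_card hBs
      rw [card_map] at this
      omega
    · have := h _ hBs (t \ N) sdiff_subset (hB.map) hA (by
        intro b hb a ha
        obtain ⟨b', hb', rfl⟩ := mem_map.1 hb
        by_contra hF
        rw [mem_sdiff] at ha
        exact ha.2 (mem_biUnion.2 ⟨b', hb', mem_filter.2 ⟨ha.1, hF⟩⟩))
      rw [card_map] at this
      omega
  obtain ⟨g, hg, hg'⟩ := (all_card_le_biUnion_card_iff_exists_injective _).1 hall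
  refine ⟨fun z => if hz : z ∈ s then g ⟨z, hz⟩ else Classical.arbitrary α, ?_, ?_, ?_⟩
  · intro z hz w hw hzw
    have hz : z ∈ s := hz
    have hw : w ∈ s := hw
    simp only [hz, hw, dif_pos] at hzw
    exact congrArg Subtype.val (hg hzw)
  · intro z hz
    simp only [hz, dif_pos]
    exact (mem_filter.1 (hg' ⟨z, hz⟩)).1
  · intro z hz
    simp only [hz, dif_pos]
    exact (mem_filter.1 (hg' ⟨z, hz⟩)).2

/-! ### Rainbow colorings of matched families -/

/-- A family of pairwise disjoint vertex sets of size `n`, such that a vertex of one of them has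
at most one neighbor in each of the others. -/
structure IsMatchedFamily {V ι : Type*} (G : SimpleGraph V) (U : Finset ι) (S : ι → Finset V)
    (n : ℕ) : Prop where
  card : ∀ i ∈ U, #(S i) = n
  disj : ∀ i ∈ U, ∀ j ∈ U, i ≠ j → Disjoint (S i) (S j)
  unique : ∀ i ∈ U, ∀ j ∈ U, i ≠ j → ∀ z ∈ S i, ∀ w ∈ S j, ∀ w' ∈ S j,
    G.Adj z w → G.Adj z w' → w = w'

/-- The map `c` colors each `S i` with pairwise distinct colors from the palette `C i`, and
adjacent vertices from distinct sets get distinct colors. -/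
structure IsRainbowOn {V ι α : Type*} (G : SimpleGraph V) (S : ι → Finset V) (C : ι → Finset α)
    (I : Finset ι) (c : V → α) : Prop where
  inj : ∀ i ∈ I, Set.InjOn c (S i)
  mem : ∀ i ∈ I, ∀ z ∈ S i, c z ∈ C i
  proper : ∀ i ∈ I, ∀ j ∈ I, i ≠ j → ∀ z ∈ S i, ∀ w ∈ S j, G.Adj z w → c z ≠ c w

/-- The color `a` occurs at a neighbor of `z` in the sets with indices in `I`. -/
def IsBlocked {V ι α : Type*} (G : SimpleGraph V) (S : ι → Finset V) (I : Finset ι) (c : V → α)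
    (z : V) (a : α) : Prop :=
  ∃ i ∈ I, ∃ w ∈ S i, G.Adj z w ∧ c w = a

open Classical in
/-- The number of sets with indices in `I` that contain a neighbor of `z`. -/
noncomputable def setDegree {V ι : Type*} (G : SimpleGraph V) (S : ι → Finset V) (I : Finset ι)
    (z : V) : ℕ :=
  #{i ∈ I | ∃ w ∈ S i, G.Adj z w}

section

variable {V ι α : Type*} {G : SimpleGraph V} {U I : Finset ι} {S : ι → Finset V}
  {C : ι → Finset α} {n : ℕ} {c : V → α} {L : ι}

theorem setDegree_le_card (z : V) : setDegree G S I z ≤ #I := by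
  classical
  exact card_le_card (filter_subset _ _)

theorem isBlocked_insert [DecidableEq ι] {z : V} {a : α} :
    IsBlocked G S (insert L I) c z a ↔ IsBlocked G S {L} c z a ∨ IsBlocked G S I c z a := by
  simp [IsBlocked]

theorem isBlocked_congr {c' : V → α} (h : ∀ i ∈ I, ∀ z ∈ S i, c' z = c z) {z : V} {a : α} :
    IsBlocked G S I c' z a ↔ IsBlocked G S I c z a := by
  unfold IsBlocked
  constructor <;> rintro ⟨i, hi, w, hw, h1, h2⟩ <;> refine ⟨i, hi, w, hw, h1, ?_⟩
  · rw [← h i hi w hw, h2]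
  · rw [h i hi w hw, h2]

/-- Distinct colors are blocked from distinct sets, because `z` has at most one neighbor in each. -/
theorem IsMatchedFamily.card_blocked_colors_le (hS : IsMatchedFamily G U S n) (hIU : I ⊆ U)
    (hL : L ∈ U) (hLI : L ∉ I) {z : V} (hz : z ∈ S L) {A : Finset α}
    (hA : ∀ a ∈ A, IsBlocked G S I c z a) : #A ≤ setDegree G S I z := by
  classical
  have : Nonempty ι := ⟨L⟩
  have : Nonempty V := ⟨z⟩
  choose! i hi w hw hzw hcw using hA
  refine card_le_card_of_injOn i (fun a ha => ?_) ?_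
  · exact mem_coe.2 (mem_filter.2 ⟨hi a ha, w a, hw a ha, hzw a ha⟩)
  · intro a ha b hb hab
    have ha : a ∈ A := ha
    have hb : b ∈ A := hb
    rw [← hcw a ha, ← hcw b hb]
    congr 1
    exact hS.unique L hL (i a) (hIU (hi a ha)) (fun h => hLI (h ▸ hi a ha)) z hz _ (hw a ha) _
      (hab ▸ hw b hb) (hzw a ha) (hzw b hb)

/-- The color `a` occurs at most once in each `S i`, and that occurrence has at most one neighbor in
`S L`. Hence each index blocks `a` at one vertex of `S L` at most. -/
theorem IsMatchedFamily.exists_mapping_of_blocked (hS : IsMatchedFamily G U S n) (hIU : I ⊆ U)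
    (hL : L ∈ U) (hLI : L ∉ I) (hc : IsRainbowOn G S C I c) {a : α} {B : Finset V}
    (hBL : B ⊆ S L) (hB : ∀ b ∈ B, IsBlocked G S I c b a) :
    ∃ f : V → ι, Set.InjOn f B ∧
      ∀ b ∈ B, f b ∈ I ∧ ∃ w ∈ S (f b), G.Adj b w ∧ c w = a := by
  classical
  have : Nonempty ι := ⟨L⟩
  rcases B.eq_empty_or_nonempty with rfl | ⟨b₀, -⟩
  · exact ⟨fun _ => L, by simp, by simp⟩
  have : Nonempty V := ⟨b₀⟩
  choose! i hi w hw hbw hcw using hB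
  refine ⟨i, ?_, fun b hb => ⟨hi b hb, w b, hw b hb, hbw b hb, hcw b hb⟩⟩
  intro b hb b' hb' h
  have hb : b ∈ B := hb
  have hb' : b' ∈ B := hb'
  have hww : w b = w b' := hc.inj (i b) (hi b hb) (hw b hb) (h ▸ hw b' hb')
    ((hcw b hb).trans (hcw b' hb').symm)
  refine hS.unique (i b) (hIU (hi b hb)) L hL (fun h => hLI (h ▸ hi b hb)) (w b) (hw b hb)
    b (hBL hb) b' (hBL hb') (hbw b hb).symm ?_
  rw [hww]
  exact (hbw b' hb').symm

theorem IsMatchedFamily.card_blocked_vertices_le (hS : IsMatchedFamily G U S n) (hIU : I ⊆ U)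
    (hL : L ∈ U) (hLI : L ∉ I) (hc : IsRainbowOn G S C I c) {a : α} {B : Finset V}
    (hBL : B ⊆ S L) (hB : ∀ b ∈ B, IsBlocked G S I c b a) : #B ≤ #I := by
  obtain ⟨f, hf, hf'⟩ := hS.exists_mapping_of_blocked hIU hL hLI hc hBL hB
  exact card_le_card_of_injOn f (fun b hb => (hf' b hb).1) hf

/-- If a color is blocked at as many vertices of `S L` as there are sets, then each set
contributes. -/
theorem IsMatchedFamily.exists_of_card_le_blocked (hS : IsMatchedFamily G U S n) (hIU : I ⊆ U)
    (hL : L ∈ U) (hLI : L ∉ I) (hc : IsRainbowOn G S C I c) {a : α} {B : Finset V}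
    (hBL : B ⊆ S L) (hB : ∀ b ∈ B, IsBlocked G S I c b a) (hcard : #I ≤ #B) {i : ι}
    (hi : i ∈ I) : ∃ b ∈ B, ∃ w ∈ S i, G.Adj b w ∧ c w = a := by
  obtain ⟨f, hf, hf'⟩ := hS.exists_mapping_of_blocked hIU hL hLI hc hBL hB
  obtain ⟨b, hb, rfl⟩ := surjOn_of_injOn_of_card_le f (fun b hb => (hf' b hb).1) hf hcard hi
  exact ⟨b, hb, (hf' b hb).2⟩

theorem IsMatchedFamily.extend [DecidableEq ι] (hS : IsMatchedFamily G U S n) (hIU : I ⊆ U)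
    (hL : L ∈ U) (hLI : L ∉ I) (hc : IsRainbowOn G S C I c) {f : V → α}
    (hf : Set.InjOn f (S L)) (hfC : ∀ z ∈ S L, f z ∈ C L)
    (hfb : ∀ z ∈ S L, ¬ IsBlocked G S I c z (f z)) :
    ∃ c' : V → α, IsRainbowOn G S C (insert L I) c' ∧ (∀ i ∈ I, ∀ z ∈ S i, c' z = c z) ∧
      ∀ z ∈ S L, c' z = f z := by
  classical
  set c' : V → α := fun v => if v ∈ S L then f v else c v with hc'
  have h1 : ∀ z ∈ S L, c' z = f z := fun z hz => by simp [hc', hz]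
  have h2 : ∀ i ∈ I, ∀ z ∈ S i, c' z = c z := fun i hi z hz => by
    have : z ∉ S L := Finset.disjoint_left.1
      (hS.disj i (hIU hi) L hL fun h => hLI (h ▸ hi)) hz
    simp [hc', this]
  have key : ∀ j ∈ I, ∀ z ∈ S L, ∀ w ∈ S j, G.Adj z w → c' z ≠ c' w := by
    intro j hj z hz w hw hzw h
    rw [h1 z hz, h2 j hj w hw] at h
    exact hfb z hz ⟨j, hj, w, hw, hzw, h.symm⟩
  refine ⟨c', ⟨?_, ?_, ?_⟩, h2, h1⟩
  · intro i hi
    rcases mem_insert.1 hi with rfl | hi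
    · exact hf.congr fun z hz => (h1 z hz).symm
    · exact (hc.inj i hi).congr fun z hz => (h2 i hi z hz).symm
  · intro i hi z hz
    rcases mem_insert.1 hi with rfl | hi
    · rw [h1 z hz]; exact hfC z hz
    · rw [h2 i hi z hz]; exact hc.mem i hi z hz
  · intro i hi j hj hij z hz w hw hzw
    rcases mem_insert.1 hi with h | hi' <;> rcases mem_insert.1 hj with h' | hj'
    · exact absurd (h.trans h'.symm) hij
    · exact key j hj' z (h ▸ hz) w hw hzw
    · exact (key i hi' w (h' ▸ hw) z hz hzw.symm).symm
    · rw [h2 i hi' z hz, h2 j hj' w hw]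
      exact hc.proper i hi' j hj' hij z hz w hw hzw

variable [Nonempty α] [DecidableEq ι]

/-- Either the coloring extends to `S L`, or there is an obstruction. -/
theorem IsMatchedFamily.extend_or_obstruction (hS : IsMatchedFamily G U S n) (hIU : I ⊆ U)
    (hL : L ∈ U) (hLI : L ∉ I) (hc : IsRainbowOn G S C I c) (hC : #(C L) = n) :
    (∃ c' : V → α, IsRainbowOn G S C (insert L I) c' ∧ ∀ i ∈ I, ∀ z ∈ S i, c' z = c z) ∨
    ∃ B ⊆ S L, ∃ A ⊆ C L, B.Nonempty ∧ A.Nonempty ∧ n < #A + #B ∧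
      (∀ b ∈ B, ∀ a ∈ A, IsBlocked G S I c b a) ∧ #B ≤ #I ∧ #A ≤ #I ∧
      ∀ b ∈ B, #A ≤ setDegree G S I b := by
  by_cases h : ∀ B ⊆ S L, ∀ A ⊆ C L, B.Nonempty → A.Nonempty →
      (∀ b ∈ B, ∀ a ∈ A, IsBlocked G S I c b a) → #A + #B ≤ #(C L)
  · left
    obtain ⟨f, hf, hfC, hfb⟩ := exists_injOn_avoiding (S L) (C L) _
      (by rw [hS.card L hL, hC]) h
    obtain ⟨c', h1, h2, -⟩ := hS.extend hIU hL hLI hc hf hfC hfb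
    exact ⟨c', h1, h2⟩
  · right
    push Not at h
    obtain ⟨B, hB, A, hA, ⟨b, hb⟩, ⟨a, ha⟩, hAB, hcard⟩ := h
    have hdeg : ∀ b ∈ B, #A ≤ setDegree G S I b := fun b hb =>
      hS.card_blocked_colors_le hIU hL hLI (hB hb) (hAB b hb)
    exact ⟨B, hB, A, hA, ⟨b, hb⟩, ⟨a, ha⟩, hC ▸ hcard, hAB,
      hS.card_blocked_vertices_le hIU hL hLI hc hB fun b hb => hAB b hb a ha,
      (hdeg b hb).trans (setDegree_le_card b), hdeg⟩

theorem IsMatchedFamily.extend_of_two_mul_card_le (hS : IsMatchedFamily G U S n) (hIU : I ⊆ U)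
    (hL : L ∈ U) (hLI : L ∉ I) (hc : IsRainbowOn G S C I c) (hC : #(C L) = n)
    (hn : 2 * #I ≤ n) :
    ∃ c' : V → α, IsRainbowOn G S C (insert L I) c' ∧ ∀ i ∈ I, ∀ z ∈ S i, c' z = c z := by
  rcases hS.extend_or_obstruction hIU hL hLI hc hC with h | ⟨B, -, A, -, -, -, h, -, h1, h2, -⟩
  · exact h
  · omega

/-- Fixing one value removes one vertex and one color, so Hall's theorem is applied with `n - 1` in
place of `n`; hence the `+ 1` in `hn`. -/
theorem IsMatchedFamily.extend_with_value (hS : IsMatchedFamily G U S n) (hIU : I ⊆ U)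
    (hL : L ∈ U) (hLI : L ∉ I) (hc : IsRainbowOn G S C I c) (hC : #(C L) = n)
    (hn : 2 * #I + 1 ≤ n) {z : V} {a : α} (hz : z ∈ S L) (ha : a ∈ C L)
    (hza : ¬ IsBlocked G S I c z a) :
    ∃ c' : V → α, IsRainbowOn G S C (insert L I) c' ∧ (∀ i ∈ I, ∀ z ∈ S i, c' z = c z) ∧
      c' z = a := by
  classical
  have hs := card_erase_of_mem hz
  have ht := card_erase_of_mem ha
  rw [hS.card L hL] at hs
  rw [hC] at ht
  obtain ⟨f, hf, hfC, hfb⟩ := exists_injOn_avoiding ((S L).erase z) ((C L).erase a)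
    (IsBlocked G S I c) (by omega) (by
      intro B hB A hA ⟨b, hb⟩ ⟨a', ha'⟩ hAB
      have hB' := hB.trans (erase_subset _ _)
      have h1 := hS.card_blocked_colors_le hIU hL hLI (hB' hb) (hAB b hb)
      have h2 := setDegree_le_card (G := G) (S := S) (I := I) b
      have h3 := hS.card_blocked_vertices_le hIU hL hLI hc hB' fun b hb => hAB b hb a' ha'
      omega)
  have hne : ∀ w ∈ S L, w ≠ z → w ∈ (S L).erase z := fun w hw h => mem_erase.2 ⟨h, hw⟩
  obtain ⟨c', h1, h2, h3⟩ := hS.extend (f := Function.update f z a) hIU hL hLI hc (by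
      intro v hv w hw hvw
      by_cases h1 : v = z <;> by_cases h2 : w = z
      · rw [h1, h2]
      · subst h1
        rw [Function.update_self, Function.update_of_ne h2] at hvw
        exact absurd hvw.symm (mem_erase.1 (hfC w (hne w hw h2))).1
      · subst h2
        rw [Function.update_self, Function.update_of_ne h1] at hvw
        exact absurd hvw (mem_erase.1 (hfC v (hne v hv h1))).1
      · rw [Function.update_of_ne h1, Function.update_of_ne h2] at hvw
        exact hf (mem_coe.2 (hne v hv h1)) (mem_coe.2 (hne w hw h2)) hvw)
    (by
      intro v hv
      by_cases h1 : v = z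
      · rw [h1, Function.update_self]; exact ha
      · rw [Function.update_of_ne h1]; exact (mem_erase.1 (hfC v (hne v hv h1))).2)
    (by
      intro v hv
      by_cases h1 : v = z
      · rw [h1, Function.update_self]; exact hza
      · rw [Function.update_of_ne h1]; exact hfb v (hne v hv h1))
  exact ⟨c', h1, h2, by rw [h3 z hz, Function.update_self]⟩

/-- Only the last set meets as many as `#I - 1` colored sets, which is why `hn` involves `#I - 1`.
-/
theorem IsMatchedFamily.exists_isRainbowOn (hS : IsMatchedFamily G U S n) (hIU : I ⊆ U)
    (hC : ∀ i ∈ I, #(C i) = n) (hn : 2 * (#I - 1) ≤ n) : ∃ c : V → α, IsRainbowOn G S C I c := by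
  induction I using Finset.induction_on with
  | empty => exact ⟨fun _ => Classical.arbitrary α, by simp, by simp, by simp⟩
  | insert L I hLI ih =>
    rw [card_insert_of_notMem hLI] at hn
    rw [insert_subset_iff] at hIU
    obtain ⟨c, hc⟩ := ih hIU.2 (fun i hi => hC i (mem_insert_of_mem hi)) (by omega)
    obtain ⟨c', h, -⟩ := hS.extend_of_two_mul_card_le hIU.2 hIU.1 hLI hc
      (hC L (mem_insert_self _ _)) (by omega)
    exact ⟨c', h⟩

/-- One set more than in `IsMatchedFamily.exists_isRainbowOn` is possible: the obstruction to the
last extension is determined by all but one of the sets, and that one can be recolored. -/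
theorem IsMatchedFamily.exists_isRainbowOn_of_odd {k : ℕ} (hk : 3 ≤ k)
    (hS : IsMatchedFamily G U S (2 * k - 1)) (hIU : I ⊆ U)
    (hC : ∀ i ∈ I, #(C i) = 2 * k - 1) (hI : #I = k + 1) : ∃ c : V → α, IsRainbowOn G S C I c := by
  classical
  obtain ⟨L, I', hLI', rfl, hI'⟩ := card_eq_succ.1 hI
  obtain ⟨J, P, hJP, rfl, hP⟩ : ∃ J P, J ∉ P ∧ insert J P = I' ∧ #P = k - 1 :=
    card_eq_succ.1 (by omega)
  have hJU : J ∈ U := hIU (by simp)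
  have hLU : L ∈ U := hIU (by simp)
  have hQU : insert J P ⊆ U := (subset_insert _ _).trans hIU
  have hPU : P ⊆ U := (subset_insert _ _).trans hQU
  have hLP : L ∉ P := fun h => hLI' (mem_insert_of_mem h)
  have hLJ : L ∉ ({J} : Finset ι) := fun h => hLI' (by simp_all)
  have hCJ : #(C J) = 2 * k - 1 := hC J (by simp)
  have hCL : #(C L) = 2 * k - 1 := hC L (by simp)
  obtain ⟨c₀, hc₀⟩ := hS.exists_isRainbowOn (α := α) (C := C) hPU
    (fun i hi => hC i (by simp [hi])) (by omega)
  -- what an obstruction sees of the common part `P`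
  have facts : ∀ c : V → α, IsRainbowOn G S C (insert J P) c →
      (∀ i ∈ P, ∀ z ∈ S i, c z = c₀ z) → ∀ B ⊆ S L, ∀ A : Finset α, #B = k → #A = k →
      (∀ b ∈ B, ∀ a ∈ A, IsBlocked G S (insert J P) c b a) →
      (∀ b ∈ B, k - 1 ≤ #{a ∈ A | IsBlocked G S P c₀ b a}) ∧
      (∀ a ∈ A, ∀ i ∈ P, ∃ b ∈ B, ∃ w ∈ S i, G.Adj b w ∧ c₀ w = a) ∧
      (∀ b ∈ B, ∀ i ∈ P, ∀ w ∈ S i, G.Adj b w → c₀ w ∈ A) ∧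
      (∀ a ∈ A, ∃ b ∈ B, ∃ w ∈ S J, G.Adj b w ∧ c w = a) := by
    intro c hc hcc B hB A hBk hAk hAB
    -- The obstruction is tight: `#B` equals the number `k` of colored sets, so each of them blocks
    -- `a` at some vertex of `B`.
    have h2 : ∀ a ∈ A, ∀ i ∈ insert J P, ∃ b ∈ B, ∃ w ∈ S i, G.Adj b w ∧ c w = a :=
      fun a ha i hi => hS.exists_of_card_le_blocked hQU hLU hLI' hc hB
        (fun b hb => hAB b hb a ha) (by omega) hi
    refine ⟨fun b hb => ?_, fun a ha i hi => ?_, fun b hb i hi w hw hbw => ?_,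
      fun a ha => h2 a ha J (mem_insert_self _ _)⟩
    · have h := hS.card_blocked_colors_le (c := c) (A := {a ∈ A | ¬ IsBlocked G S P c₀ b a})
        (singleton_subset_iff.2 hJU) hLU hLJ (hB hb) (by
          intro a ha
          rw [mem_filter] at ha
          rcases isBlocked_insert.1 (hAB b hb a ha.1) with h | h
          · exact h
          · exact absurd ((isBlocked_congr hcc).1 h) ha.2)
      have h' := h.trans (setDegree_le_card b)
      rw [card_singleton] at h'
      have := card_filter_add_card_filter_not (s := A) (fun a => IsBlocked G S P c₀ b a)
      omega
    · obtain ⟨b, hb, w, hw, h, h'⟩ := h2 a ha i (mem_insert_of_mem hi)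
      exact ⟨b, hb, w, hw, h, by rw [← hcc i hi w hw, h']⟩
    · by_contra hwA
      have h := hS.card_blocked_colors_le (c := c) (A := insert (c₀ w) A)
        hQU hLU hLI' (hB hb) (by
          intro a ha
          rcases mem_insert.1 ha with rfl | ha
          · exact ⟨i, mem_insert_of_mem hi, w, hw, hbw, hcc i hi w hw⟩
          · exact hAB b hb a ha)
      have h' := h.trans (setDegree_le_card b)
      rw [card_insert_of_notMem hwA] at h'
      omega
  obtain ⟨c₁, hc₁, hc₁'⟩ := hS.extend_of_two_mul_card_le hPU hJU hJP hc₀ hCJ (by omega)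
  rcases hS.extend_or_obstruction hQU hLU hLI' hc₁ hCL with
    ⟨c, h, -⟩ | ⟨B, hB, A, hA, hBne, -, hcard, hAB, hBle, hAle, -⟩
  · exact ⟨c, h⟩
  have hBk : #B = k := by omega
  have hAk : #A = k := by omega
  obtain ⟨-, hA1, hA2, hA3⟩ := facts c₁ hc₁ hc₁' B hB A hBk hAk hAB
  have hAJ : A ⊆ C J := fun a ha => by
    obtain ⟨b, -, w, hw, -, rfl⟩ := hA3 a ha
    exact hc₁.mem J (mem_insert_self _ _) w hw
  -- Each of the `k` vertices of `B` has at most one neighbor in `S J`, which has `2 * k - 1 > k`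
  -- vertices. Giving `z` a color `a ∈ A` keeps `a` in `S J` away from `B` and so destroys this
  -- obstruction.
  obtain ⟨z, hz, hzB⟩ : ∃ z ∈ S J, ∀ b ∈ B, ¬ G.Adj b z := by
    by_contra! hcon
    choose! b hb hbz using hcon
    have := card_le_card_of_injOn b (s := S J) (t := B) hb (by
      intro z hz w hw hzw
      exact hS.unique L hLU J hJU (fun h => hLJ (by simp [h])) (b z) (hB (hb z hz)) z hz w hw
        (hbz z hz) (hzw ▸ hbz w hw))
    rw [hS.card J hJU] at this
    omega
  obtain ⟨a, haA, haz⟩ : ∃ a ∈ A, ¬ IsBlocked G S P c₀ z a := by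
    by_contra! hcon
    have := (hS.card_blocked_colors_le hPU hJU hJP hz hcon).trans (setDegree_le_card z)
    omega
  obtain ⟨c₂, hc₂, hc₂', hza⟩ :=
    hS.extend_with_value hPU hJU hJP hc₀ hCJ (by omega) hz (hAJ haA) haz
  rcases hS.extend_or_obstruction hQU hLU hLI' hc₂ hCL with
    ⟨c, h, -⟩ | ⟨B', hB', A', -, -, -, hcard', hAB', hBle', hAle', -⟩
  · exact ⟨c, h⟩
  exfalso
  have hBk' : #B' = k := by omega
  have hAk' : #A' = k := by omega
  obtain ⟨hB0', hA1', hA2', hA3'⟩ := facts c₂ hc₂ hc₂' B' hB' A' hBk' hAk' hAB'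
  obtain ⟨b₀, hb₀⟩ : (B ∩ B').Nonempty := by
    rw [← card_pos]
    have h1 := card_inter_add_card_union B B'
    have h2 := card_le_card (union_subset hB hB')
    rw [hS.card L hLU] at h2
    omega
  rw [mem_inter] at hb₀
  have hinter : k - 1 ≤ #(A' ∩ A) := by
    refine (hB0' b₀ hb₀.2).trans (card_le_card fun a ha => ?_)
    obtain ⟨ha, i, hi, w, hw, hbw, rfl⟩ := mem_filter.1 ha
    exact mem_inter.2 ⟨ha, hA2 b₀ hb₀.1 i hi w hw hbw⟩
  have hBB : B' ⊆ B := by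
    intro b hb
    by_contra hbB
    -- In each `S i` with `i ∈ P`, the vertex with a given color of `A` has its only neighbor in `S
    -- L` inside `B`. So a vertex `b` outside `B` sees in `P` only colors outside `A`; this gives `2
    -- * (k - 1) ≤ k`, against `3 ≤ k`.
    have hsub : {a ∈ A' | IsBlocked G S P c₀ b a} ⊆ A' \ A := by
      intro a ha
      obtain ⟨ha, i, hi, w, hw, hbw, rfl⟩ := mem_filter.1 ha
      refine mem_sdiff.2 ⟨ha, fun haA => ?_⟩
      obtain ⟨b', hb', w', hw', hbw', h⟩ := hA1 _ haA i hi
      have hne : i ≠ L := fun h => hLP (h ▸ hi)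
      have hww : w' = w := hc₀.inj i hi hw' hw h
      subst hww
      exact hbB (hS.unique i (hPU hi) L hLU hne w' hw b (hB' hb) b' (hB hb') hbw.symm
        hbw'.symm ▸ hb')
    have h1 := (hB0' b hb).trans (card_le_card hsub)
    have h2 := card_sdiff_add_card_inter A' A
    omega
  have hBeq : B' = B := eq_of_subset_of_card_le hBB (by omega)
  obtain ⟨i₀, hi₀⟩ : P.Nonempty := card_pos.1 (by omega)
  have hAA : A' ⊆ A := fun a ha => by
    obtain ⟨b, hb, w, hw, hbw, rfl⟩ := hA1' a ha i₀ hi₀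
    exact hA2 b (hBB hb) i₀ hi₀ w hw hbw
  have hAeq : A' = A := eq_of_subset_of_card_le hAA (by omega)
  obtain ⟨b, hb, w, hw, hbw, hwa⟩ := hA3' a (hAeq ▸ haA)
  have : w = z := hc₂.inj J (mem_insert_self _ _) hw hz (hwa.trans hza.symm)
  exact hzB b (hBB hb) (this ▸ hbw)

end

/-! ### Averaging: choosing sets with few incidences -/

theorem exists_subset_forall_le {ι : Type*} [DecidableEq ι] (U : Finset ι) (w : ι → ℕ) {m : ℕ}
    (hm : m ≤ #U) : ∃ R ⊆ U, #R = m ∧ ∀ i ∈ R, ∀ j ∈ U \ R, w i ≤ w j := by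
  obtain ⟨R, hR, hmin⟩ := exists_min_image (powersetCard m U) (fun R => ∑ i ∈ R, w i)
    (powersetCard_nonempty.2 hm)
  rw [mem_powersetCard] at hR
  refine ⟨R, hR.1, hR.2, fun i hi j hj => ?_⟩
  rw [mem_sdiff] at hj
  have hj' : j ∉ R.erase i := fun h => hj.2 (mem_of_mem_erase h)
  have h := hmin (insert j (R.erase i)) (mem_powersetCard.2
    ⟨insert_subset hj.1 ((erase_subset _ _).trans hR.1), by
      rw [card_insert_of_notMem hj', card_erase_add_one hi, hR.2]⟩)
  have h' := add_sum_erase R w hi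
  simp only [sum_insert hj'] at h
  omega

/-- If the `k + 1` smallest weights summed to `k * (k + 1)` or more, one of them would be at least
`k`, hence also the other `3 * k`, for a total of at least `4 * k ^ 2 + k`. -/
theorem exists_subset_sum_lt {ι : Type*} [DecidableEq ι] {U : Finset ι} {w : ι → ℕ} {k : ℕ}
    (hk : 1 ≤ k) (hU : #U = 4 * k + 1) (hw : ∑ i ∈ U, w i ≤ (2 * k) * (2 * k)) :
    ∃ R ⊆ U, #R = k + 1 ∧ ∑ i ∈ R, w i < k * (k + 1) := by
  obtain ⟨R, hRU, hR, hmin⟩ := exists_subset_forall_le U w (m := k + 1) (by omega)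
  refine ⟨R, hRU, hR, ?_⟩
  by_contra! hcon
  obtain ⟨i, hi, hik⟩ : ∃ i ∈ R, k ≤ w i := by
    by_contra! hlt
    have h := sum_le_card_nsmul R w (k - 1) fun i hi => by have := hlt i hi; omega
    rw [hR, smul_eq_mul] at h
    obtain ⟨k, rfl⟩ := Nat.exists_eq_add_of_le hk
    simp only [add_tsub_cancel_left] at h
    nlinarith
  have h := card_nsmul_le_sum (U \ R) w k fun j hj => hik.trans (hmin i hi j hj)
  have hc := card_sdiff_add_card_eq_card hRU
  rw [smul_eq_mul, show #(U \ R) = 3 * k by omega] at h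
  have h' := sum_sdiff (f := w) hRU
  nlinarith

/-- In a bipartite incidence structure between `L` and `U`, some `k + 1` elements of `U` do not
admit many elements of `L` incident with many of them. -/
theorem exists_subset_forall_card_add_lt {V ι : Type*} [DecidableEq ι] {L : Finset V}
    {U : Finset ι} (r : V → ι → Prop) [∀ z i, Decidable (r z i)] {k : ℕ} (hk : 3 ≤ k)
    (hU : #U = 4 * k - 1)
    (hL : #L = 2 * k - 1) (hdeg : ∀ z ∈ L, #{i ∈ U | r z i} ≤ 2 * k - 1) :
    ∃ R ⊆ U, #R = k + 1 ∧ ∀ B ⊆ L, ∀ a, #B ≤ k + 1 → a ≤ k + 1 →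
      (∀ z ∈ B, a ≤ #{i ∈ R | r z i}) → #B + a < 2 * k := by
  classical
  by_contra! hcon
  set w : ι → ℕ := fun i => #{z ∈ L | r z i} with hw
  have hcount : ∀ R : Finset ι, ∑ i ∈ R, w i = ∑ z ∈ L, #{i ∈ R | r z i} := fun R =>
    (sum_card_bipartiteAbove_eq_sum_card_bipartiteBelow r).symm
  -- The extreme case is `{a, b} = {k - 1, k + 1}`. Thus a bad `R` carries at least `k ^ 2 - 1`
  -- incidences.
  have hprod : ∀ a b, a ≤ k + 1 → b ≤ k + 1 → 2 * k ≤ b + a → k * k ≤ b * a + 1 := by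
    intro a b ha hb hab
    obtain ⟨p, rfl⟩ : ∃ p, k = p + 1 := ⟨k - 1, by omega⟩
    rcases (show a = p ∨ p + 1 ≤ a by omega) with rfl | h1
    · nlinarith
    · rcases (show b = p ∨ p + 1 ≤ b by omega) with rfl | h2
      · nlinarith
      · nlinarith
  have hbig : ∀ R ⊆ U, #R = k + 1 → k * k ≤ (∑ i ∈ R, w i) + 1 := by
    intro R hRU hR
    obtain ⟨B, hB, a, hBk, hak, hdB, hsum⟩ := hcon R hRU hR
    have h1 := card_nsmul_le_sum B (fun z => #{i ∈ R | r z i}) a hdB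
    have h2 := sum_le_sum_of_subset (f := fun z => #{i ∈ R | r z i}) hB
    have h3 := hprod a (#B) hak hBk hsum
    rw [hcount R]
    rw [smul_eq_mul] at h1
    omega
  have htot : ∑ i ∈ U, w i ≤ (2 * k - 1) * (2 * k - 1) := by
    rw [hcount U]
    have h := sum_le_card_nsmul L (fun z => #{i ∈ U | r z i}) (2 * k - 1) hdeg
    rwa [hL, smul_eq_mul] at h
  obtain ⟨R, hRU, hR, hmin⟩ := exists_subset_forall_le U w (m := k + 1) (by omega)
  have hcU := card_sdiff_add_card_eq_card hRU
  have hsU := sum_sdiff (f := w) hRU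
  have hRbig := hbig R hRU hR
  obtain ⟨p, rfl⟩ : ∃ p, k = p + 1 := ⟨k - 1, by omega⟩
  have hle : ∀ i ∈ R, w i ≤ p := by
    intro i hi
    by_contra! hip
    have h := card_nsmul_le_sum (U \ R) w (p + 1) fun j hj =>
      Nat.succ_le_of_lt (hip.trans_le (hmin i hi j hj))
    rw [smul_eq_mul, show #(U \ R) = 3 * p + 1 by omega] at h
    rw [show 2 * (p + 1) - 1 = 2 * p + 1 by omega] at htot
    nlinarith
  -- With `k = p + 1`, the `p + 2` weights in `R` are at most `p` and sum to at least `p * (p + 2)`,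
  -- so all are equal to `p`.
  have heq : ∀ i ∈ R, w i = p := by
    by_contra! hne
    obtain ⟨i, hi, hip⟩ := hne
    have h := sum_lt_sum hle ⟨i, hi, lt_of_le_of_ne (hle i hi) hip⟩
    rw [sum_const, hR, smul_eq_mul] at h
    nlinarith
  obtain ⟨i₀, hi₀⟩ : R.Nonempty := card_pos.1 (by omega)
  have hge : ∀ j ∈ U, p ≤ w j := by
    intro j hj
    by_cases h : j ∈ R
    · exact (heq j h).ge
    · exact (heq i₀ hi₀).ge.trans (hmin i₀ hi₀ j (mem_sdiff.2 ⟨hj, h⟩))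
  set M := {i ∈ U | w i = p} with hM
  have hMcard : 3 * p + 2 ≤ #M := by
    have hMU : M ⊆ U := filter_subset _ _
    have h1 := card_sdiff_add_card_eq_card hMU
    have h2 := sum_sdiff (f := w) hMU
    have h3 := card_nsmul_le_sum (U \ M) w (p + 1) fun j hj => by
      rw [mem_sdiff, hM, mem_filter, not_and] at hj
      exact Nat.succ_le_of_lt (lt_of_le_of_ne (hge j hj.1) fun h => hj.2 hj.1 h.symm)
    have h4 : ∑ i ∈ M, w i = #M * p := by
      rw [sum_congr rfl (fun i hi => (mem_filter.1 hi).2), sum_const, smul_eq_mul]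
    rw [h4] at h2
    rw [smul_eq_mul] at h3
    rw [show 2 * (p + 1) - 1 = 2 * p + 1 by omega] at htot
    have h5 : #(U \ M) + #M = 4 * p + 3 := by omega
    nlinarith
  obtain ⟨z, hz⟩ : {z ∈ L | r z i₀}.Nonempty := by
    rw [← card_pos]
    have : w i₀ = p := heq i₀ hi₀
    simp only [hw] at this
    omega
  rw [mem_filter] at hz
  have hi₀M : i₀ ∈ M := mem_filter.2 ⟨hRU hi₀, heq i₀ hi₀⟩
  -- At most `2 * p + 1` of the at least `3 * p + 2` members of `M` are incident with `z`. In
  -- `insert i₀ T` the incidences again number exactly `p * (p + 2)`, so `B` must account for all of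
  -- them. But `z` has exactly one and lies outside `B`, because `a ≥ p ≥ 2`.
  obtain ⟨T, hTM, hT⟩ : ∃ T ⊆ {i ∈ M | ¬ r z i}, #T = p + 1 := by
    refine exists_subset_card_eq ?_
    have h1 := card_filter_add_card_filter_not (s := M) (fun i => r z i)
    have h2 : #{i ∈ M | r z i} ≤ #{i ∈ U | r z i} :=
      card_le_card (filter_subset_filter _ (filter_subset _ _))
    have h3 := hdeg z hz.1
    omega
  have hi₀T : i₀ ∉ T := fun h => (mem_filter.1 (hTM h)).2 hz.2
  have hTM' : insert i₀ T ⊆ M := insert_subset hi₀M (hTM.trans (filter_subset _ _))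
  have hTcard : #(insert i₀ T) = p + 1 + 1 := by rw [card_insert_of_notMem hi₀T, hT]
  obtain ⟨B, hB, a, hBk, hak, hdB, hsum⟩ :=
    hcon (insert i₀ T) (hTM'.trans (filter_subset _ _)) hTcard
  have hz1 : #{i ∈ insert i₀ T | r z i} = 1 := by
    rw [filter_insert, if_pos hz.2, filter_eq_empty_iff.2
      (fun i hi => (mem_filter.1 (hTM hi)).2)]
    simp
  have hzB : z ∉ B := fun h => by
    have := hdB z h
    omega
  have hs : ∑ z ∈ L, #{i ∈ insert i₀ T | r z i} = (p + 1 + 1) * p := by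
    rw [← hcount, sum_congr rfl (fun i hi => (mem_filter.1 (hTM' hi)).2), sum_const, hTcard,
      smul_eq_mul]
  have h1 := card_nsmul_le_sum B (fun z => #{i ∈ insert i₀ T | r z i}) a hdB
  have h2 := sum_le_sum_of_subset (f := fun z => #{i ∈ insert i₀ T | r z i})
    (insert_subset hz.1 hB)
  have h3 := hprod a (#B) hak hBk hsum
  rw [sum_insert hzB, hz1, hs] at h2
  rw [smul_eq_mul] at h1
  nlinarith

/-! ### Selecting a colorable subfamily -/

/-- In a matched family of `2 * (n + 1)` sets of size `n`, there are `(n + 1) / 2 + 2` sets that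
can be colored from any palettes of size `n`. -/
theorem IsMatchedFamily.exists_colorable_subset {V ι : Type*} [DecidableEq ι]
    {G : SimpleGraph V} {U : Finset ι} {S : ι → Finset V} {n : ℕ}
    (hS : IsMatchedFamily G U S n) (hn : 5 ≤ n) (hU : #U = 2 * (n + 1))
    (hdeg : ∀ i ∈ U, ∀ z ∈ S i, setDegree G S (U.erase i) z ≤ n) :
    ∃ I ⊆ U, #I = (n + 1) / 2 + 2 ∧ ∀ {α : Type*} [Nonempty α] (C : ι → Finset α),
      (∀ i ∈ I, #(C i) = n) → ∃ c : V → α, IsRainbowOn G S C I c := by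
  classical
  obtain ⟨L, hL⟩ : U.Nonempty := card_pos.1 (by omega)
  have hU' := card_erase_of_mem hL
  have hLn := hS.card L hL
  set r : V → ι → Prop := fun z i => ∃ w ∈ S i, G.Adj z w with hr
  have hsub : ∀ R ⊆ U.erase L, R ⊆ U ∧ L ∉ R := fun R hR =>
    ⟨hR.trans (erase_subset _ _), fun h => (mem_erase.1 (hR h)).1 rfl⟩
  obtain ⟨k, hk⟩ := Nat.even_or_odd' n
  rcases hk with rfl | rfl
  · obtain ⟨R, hRU, hR, hlt⟩ := exists_subset_sum_lt (U := U.erase L)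
      (w := fun i => #{z ∈ S L | r z i}) (k := k) (by omega) (by omega) (by
        have h := sum_le_card_nsmul (S L) (fun z => #{i ∈ U.erase L | r z i}) (2 * k) (hdeg L hL)
        rw [hLn, smul_eq_mul] at h
        exact (sum_card_bipartiteAbove_eq_sum_card_bipartiteBelow r).symm.trans_le h)
    obtain ⟨hRU, hLR⟩ := hsub R hRU
    refine ⟨insert L R, insert_subset hL hRU, by rw [card_insert_of_notMem hLR]; omega, ?_⟩
    intro α _ C hC
    obtain ⟨c, hc⟩ := hS.exists_isRainbowOn (α := α) (C := C) hRU
      (fun i hi => hC i (mem_insert_of_mem hi)) (by omega)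
    rcases hS.extend_or_obstruction hRU hL hLR hc (hC L (mem_insert_self _ _)) with
      ⟨c', h, -⟩ | ⟨B, hB, A, -, -, -, hAB, -, hBk, hAk, hd⟩
    · exact ⟨c', h⟩
    -- Here `#A + #B ≥ 2 * k + 1` with both at most `k + 1`, so `#A * #B ≥ k * (k + 1)`, more than
    -- the incidences that `R` has with `S L`.
    · exfalso
      have h1 := card_nsmul_le_sum B (fun z => #{i ∈ R | r z i}) (#A) hd
      have h2 := sum_le_sum_of_subset (f := fun z => #{i ∈ R | r z i}) hB
      have h3 : ∑ z ∈ S L, #{i ∈ R | r z i} = ∑ i ∈ R, #{z ∈ S L | r z i} :=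
        sum_card_bipartiteAbove_eq_sum_card_bipartiteBelow r
      rw [smul_eq_mul] at h1
      rw [hR] at hBk hAk
      rcases (show #A = k ∨ #A = k + 1 by omega) with h | h <;> rw [h] at h1 <;> nlinarith
  · have hn' : 2 * k + 1 = 2 * (k + 1) - 1 := by omega
    obtain ⟨R, hRU, hR, hB⟩ := exists_subset_forall_card_add_lt (U := U.erase L) (L := S L) r
      (k := k + 1) (by omega) (by omega) (by omega) (fun z hz => hn' ▸ hdeg L hL z hz)
    obtain ⟨hRU, hLR⟩ := hsub R hRU
    refine ⟨insert L R, insert_subset hL hRU, by rw [card_insert_of_notMem hLR]; omega, ?_⟩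
    intro α _ C hC
    obtain ⟨c, hc⟩ := (hn' ▸ hS).exists_isRainbowOn_of_odd (α := α) (C := C) (k := k + 1)
      (by omega) hRU (fun i hi => hn' ▸ hC i (mem_insert_of_mem hi)) hR
    rcases hS.extend_or_obstruction hRU hL hLR hc (hC L (mem_insert_self _ _)) with
      ⟨c', h, -⟩ | ⟨B, hBL, A, -, -, -, hAB, -, hBk, hAk, hd⟩
    · exact ⟨c', h⟩
    · have := hB B hBL (#A) (hR ▸ hBk) (hR ▸ hAk) hd
      omega

/-! ### Finiteness, short cycles, and extending colorings -/

section

variable {V : Type*} {G : SimpleGraph V}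

/-- An infinite extended diameter gives `diam` the value `0`, so here distances are bounded; balls
are finite by local finiteness. -/
theorem finite_of_diam_ne_zero [G.LocallyFinite] (h : G.diam ≠ 0) : Finite V := by
  have htop := ediam_ne_top_of_diam_ne_zero h
  have := nontrivial_of_diam_ne_zero h
  have hconn := connected_of_ediam_ne_top htop
  obtain ⟨x⟩ := hconn.nonempty
  have hball : ∀ n : ℕ, {v | G.dist x v ≤ n}.Finite := by
    intro n
    induction n with
    | zero =>
      refine (Set.finite_singleton x).subset fun v hv => ?_
      exact (hconn.dist_eq_zero_iff.1 (Nat.le_zero.1 hv)).symm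
    | succ n ih =>
      refine (ih.union (ih.biUnion fun u _ => (G.neighborSet u).toFinite)).subset fun v hv => ?_
      have hv : G.dist x v ≤ n + 1 := hv
      rcases Nat.lt_or_ge n (G.dist x v) with hlt | hle
      · obtain ⟨p, hp⟩ := hconn.exists_walk_length_eq_dist v x
        rw [dist_comm] at hp
        cases p with
        | nil => simp at hlt
        | @cons _ u _ hvu q =>
          right
          rw [Walk.length_cons] at hp
          have := dist_le q
          rw [dist_comm] at this
          exact Set.mem_biUnion (x := u) (show G.dist x u ≤ n by omega) hvu.symm
      · exact Or.inl hle
  refine Set.finite_univ_iff.1 ((hball G.diam).subset fun v _ => ?_)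
  exact dist_le_diam htop

theorem not_adj_of_three_lt_girth (h : 3 < G.girth) {a b c : V} (hab : G.Adj a b)
    (hbc : G.Adj b c) : ¬ G.Adj a c := by
  intro hac
  have hcyc : (Walk.cons hab (Walk.cons hbc (Walk.cons hac.symm Walk.nil))).IsCycle := by
    have h1 := hab.ne
    have h2 := hbc.ne
    have h3 := hac.ne
    rw [Walk.isCycle_def, Walk.isTrail_def]
    simp
    grind
  have := girth_le_length hcyc
  simp at this
  omega

theorem eq_of_adj_of_four_lt_girth (h : 4 < G.girth) {a b z w : V} (hab : a ≠ b)
    (haz : G.Adj a z) (hbz : G.Adj b z) (haw : G.Adj a w) (hbw : G.Adj b w) : z = w := by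
  by_contra hzw
  have hcyc : (Walk.cons haz (Walk.cons hbz.symm (Walk.cons hbw
      (Walk.cons haw.symm Walk.nil)))).IsCycle := by
    have h1 := haz.ne
    have h2 := hbz.ne
    have h3 := haw.ne
    have h4 := hbw.ne
    rw [Walk.isCycle_def, Walk.isTrail_def]
    simp
    grind
  have := girth_le_length hcyc
  simp at this
  omega

/-- Greedy extension of a partial proper coloring. -/
theorem exists_coloring_extending [Finite V] [G.LocallyFinite] {d : ℕ}
    (hreg : G.IsRegularOfDegree d) (W : Set V) (c : V → Fin (d + 1))
    (hc : ∀ v ∈ W, ∀ w ∈ W, G.Adj v w → c v ≠ c w) :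
    ∃ c' : G.Coloring (Fin (d + 1)), ∀ v ∈ W, c' v = c v := by
  classical
  have := Fintype.ofFinite V
  suffices H : ∀ T : Finset V, ∃ c' : V → Fin (d + 1), (∀ v ∈ W, c' v = c v) ∧
      ∀ v ∈ W ∪ T, ∀ w ∈ W ∪ T, G.Adj v w → c' v ≠ c' w by
    obtain ⟨c', h1, h2⟩ := H univ
    exact ⟨Coloring.mk c' fun {v w} hvw => h2 v (by simp) w (by simp) hvw, h1⟩
  intro T
  induction T using Finset.induction_on with
  | empty => exact ⟨c, fun _ _ => rfl, by simpa using hc⟩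
  | insert u T _ ih =>
    obtain ⟨c', h1, h2⟩ := ih
    by_cases hu : u ∈ W ∪ (T : Set V)
    · refine ⟨c', h1, ?_⟩
      have : W ∪ ((insert u T : Finset V) : Set V) = W ∪ T := by
        rw [coe_insert, Set.union_insert, Set.insert_eq_of_mem hu]
      rwa [this]
    · obtain ⟨a, ha⟩ : ∃ a, a ∉ (G.neighborFinset u).image c' := by
        by_contra! hall
        have h := card_le_card (fun a _ => hall a : univ ⊆ (G.neighborFinset u).image c')
        have h' := card_image_le (s := G.neighborFinset u) (f := c')
        rw [card_neighborFinset_eq_degree, hreg u] at h'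
        rw [card_univ, Fintype.card_fin] at h
        omega
      have ha' : ∀ w, G.Adj u w → c' w ≠ a := fun w hw h =>
        ha (mem_image.2 ⟨w, (mem_neighborFinset ..).2 hw, h⟩)
      refine ⟨Function.update c' u a, fun v hv => ?_, fun v hv w hw hvw => ?_⟩
      · rw [Function.update_of_ne (fun h : v = u => hu (Or.inl (h ▸ hv))), h1 v hv]
      · rw [coe_insert, Set.union_insert] at hv hw
        by_cases hvu : v = u <;> by_cases hwu : w = u
        · exact absurd (hvu.trans hwu.symm) hvw.ne
        · subst hvu
          rw [Function.update_self, Function.update_of_ne hwu]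
          exact (ha' w hvw).symm
        · subst hwu
          rw [Function.update_self, Function.update_of_ne hvu]
          exact ha' v hvw.symm
        · rw [Function.update_of_ne hvu, Function.update_of_ne hwu]
          exact h2 v (hv.resolve_left hvu) w (hw.resolve_left hwu) hvw

/-- The closed neighborhood has `d + 1` vertices, so if it is rainbow it shows every color. -/
theorem isDominant_of_injOn [G.LocallyFinite] [DecidableEq V] {d : ℕ}
    (hreg : G.IsRegularOfDegree d) (c : G.Coloring (Fin (d + 1))) {v : V}
    (h : Set.InjOn c (insert v (G.neighborFinset v) : Finset V)) : IsDominant c v := by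
  intro i hi
  have hcard : #((insert v (G.neighborFinset v)).image c) = d + 1 := by
    rw [card_image_of_injOn h, card_insert_of_notMem (by simp), card_neighborFinset_eq_degree,
      hreg v]
  have huniv : (insert v (G.neighborFinset v)).image c = univ :=
    (card_eq_iff_eq_univ _).1 (by rw [hcard, Fintype.card_fin])
  obtain ⟨w, hw, rfl⟩ := mem_image.1 (huniv ▸ mem_univ i)
  rcases mem_insert.1 hw with rfl | hw
  · exact absurd rfl hi
  · exact ⟨w, (mem_neighborFinset ..).1 hw, rfl⟩

theorem exists_injOn_extending {α : Type*} [Fintype α] [Nonempty α] {s T : Finset V}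
    (hsT : s ⊆ T) (hT : #T ≤ Fintype.card α) {g : V → α} (hg : Set.InjOn g s) :
    ∃ g' : V → α, Set.InjOn g' T ∧ ∀ v ∈ s, g' v = g v := by
  classical
  obtain ⟨f, hf, hf', -⟩ := exists_injOn_avoiding (T \ s) (univ \ s.image g) (fun _ _ => False)
    (by rw [card_univ_sdiff, card_sdiff_of_subset hsT, card_image_of_injOn hg]; omega)
    (fun B _ A _ ⟨b, hb⟩ ⟨a, ha⟩ h => (h b hb a ha).elim)
  have hne : ∀ v ∈ s, ∀ w ∈ T \ s, g v ≠ f w := fun v hv w hw h =>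
    (mem_sdiff.1 (hf' w hw)).2 (mem_image.2 ⟨v, hv, h⟩)
  refine ⟨fun v => if v ∈ s then g v else f v, fun v hv w hw hvw => ?_, fun v hv => by simp [hv]⟩
  by_cases h1 : v ∈ s <;> by_cases h2 : w ∈ s <;>
    simp only [h1, h2, if_true, if_false] at hvw
  · exact hg h1 h2 hvw
  · exact absurd hvw (hne v h1 w (mem_sdiff.2 ⟨hw, h2⟩))
  · exact absurd hvw.symm (hne w h2 v (mem_sdiff.2 ⟨hv, h1⟩))
  · exact hf (mem_coe.2 (mem_sdiff.2 ⟨hv, h1⟩)) (mem_coe.2 (mem_sdiff.2 ⟨hw, h2⟩)) hvw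

/-! ### From dominant vertices to `b`-colorings -/

/-- From a coloring, one obtains a `b`-coloring with at least as many colors as there are
dominant vertices of pairwise distinct colors, by eliminating one by one the colors without
dominant vertex. -/
theorem exists_isBColoring {m : ℕ} (c : G.Coloring (Fin m)) (D : Finset V)
    (hD : ∀ v ∈ D, IsDominant c v) (hinj : Set.InjOn c (D : Set V)) :
    ∃ k, #D ≤ k ∧ ∃ c' : G.Coloring (Fin k), IsBColoring c' := by
  induction m with
  | zero =>
    refine ⟨0, ?_, c, fun i => i.elim0⟩
    have := card_le_card_of_injOn (t := univ) c (fun _ _ => mem_coe.2 (mem_univ _)) hinj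
    simpa using this
  | succ m ih =>
    by_cases hb : IsBColoring c
    · refine ⟨m + 1, ?_, c, hb⟩
      have := card_le_card_of_injOn (t := univ) c (fun _ _ => mem_coe.2 (mem_univ _)) hinj
      simpa using this
    unfold IsBColoring at hb
    push Not at hb
    obtain ⟨i, hi⟩ := hb
    -- No vertex of color `i` is dominant, so each can move to a color missing from its
    -- neighborhood. The class of `i` is independent, so all can move at once; `i.succAbove`
    -- identifies `Fin m` with the remaining colors.
    have hf : ∀ v, ∃ j : Fin m, (c v ≠ i → i.succAbove j = c v) ∧
        (c v = i → ∀ w, G.Adj v w → c w ≠ i.succAbove j) := by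
      intro v
      by_cases hv : c v = i
      · have := hi v hv
        unfold IsDominant at this
        push Not at this
        obtain ⟨j, hj, hw⟩ := this
        obtain ⟨l, rfl⟩ := Fin.exists_succAbove_eq (hv ▸ hj)
        exact ⟨l, fun h => absurd hv h, fun _ => hw⟩
      · obtain ⟨l, hl⟩ := Fin.exists_succAbove_eq hv
        exact ⟨l, fun _ => hl, fun h => absurd h hv⟩
    choose f hf1 hf2 using hf
    have hDi : ∀ v ∈ D, c v ≠ i := fun v hv h => hi v h (hD v hv)
    refine ih (Coloring.mk f ?_) ?_ ?_
    · intro v w hvw h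
      have hcvw := c.valid hvw
      by_cases hv : c v = i
      · refine hf2 v hv w hvw ?_
        rw [h, hf1 w (fun h' => hcvw (hv.trans h'.symm))]
      · by_cases hw : c w = i
        · refine hf2 w hw v hvw.symm ?_
          rw [← h, hf1 v hv]
        · exact hcvw (by rw [← hf1 v hv, ← hf1 w hw, h])
    · intro v hv l hl
      have hl' : l ≠ f v := hl
      obtain ⟨w, hvw, hw⟩ := hD v hv (i.succAbove l) (fun h => hl'
        (i.succAbove_right_injective (h.trans (hf1 v (hDi v hv)).symm)))
      exact ⟨w, hvw, i.succAbove_right_injective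
        ((hf1 w (hw ▸ Fin.succAbove_ne i l)).trans hw)⟩
    · intro v hv w hw hvw
      have hvw' : f v = f w := hvw
      exact hinj hv hw (by rw [← hf1 v (hDi v hv), ← hf1 w (hDi w hw), hvw'])

/-- Boundedness is needed for `le_csSup`, as `sSup` of an unbounded set of naturals is `0`. -/
theorem bddAbove_card_dominant (d : ℕ) :
    BddAbove {n | ∃ (c : G.Coloring (Fin (d + 1))) (S : Finset V),
      (∀ v ∈ S, IsDominant c v) ∧ Set.InjOn c (S : Set V) ∧ S.card = n} := by
  refine ⟨d + 1, ?_⟩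
  rintro n ⟨c, S, -, hinj, rfl⟩
  have := card_le_card_of_injOn (t := univ) c (fun _ _ => mem_coe.2 (mem_univ _)) hinj
  simpa using this

theorem bddAbove_isBColoring [G.LocallyFinite] {d : ℕ} (hreg : G.IsRegularOfDegree d) :
    BddAbove {k | ∃ c : G.Coloring (Fin k), IsBColoring c} := by
  classical
  refine ⟨d + 1, ?_⟩
  rintro k ⟨c, hc⟩
  rcases Nat.eq_zero_or_pos k with rfl | hk
  · omega
  obtain ⟨v, -, hv⟩ := hc ⟨0, hk⟩
  have hsub : univ ⊆ (insert v (G.neighborFinset v)).image c := by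
    intro i _
    by_cases hi : i = c v
    · exact mem_image.2 ⟨v, mem_insert_self _ _, hi.symm⟩
    · obtain ⟨w, hvw, hw⟩ := hv i hi
      exact mem_image.2 ⟨w, mem_insert_of_mem ((mem_neighborFinset ..).2 hvw), hw⟩
  have h := (card_le_card hsub).trans card_image_le
  rwa [card_univ, Fintype.card_fin, card_insert_of_notMem (by simp),
    card_neighborFinset_eq_degree, hreg v] at h

end

/-! ### The coloring around two distant vertices -/

section

variable {V : Type*} {G : SimpleGraph V}

/-- Two vertices far apart in a regular graph without short cycles give rise to many dominant
vertices: the two vertices themselves, and some of their neighbors. -/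
theorem exists_coloring_dominant [Finite V] [G.LocallyFinite] {d : ℕ} (hd : 6 ≤ d)
    (hreg : G.IsRegularOfDegree d)
    (htri : ∀ {a b c : V}, G.Adj a b → G.Adj b c → ¬ G.Adj a c)
    (hquad : ∀ {a b z w : V}, a ≠ b → G.Adj a z → G.Adj b z → G.Adj a w → G.Adj b w → z = w)
    {x y : V} (hdist : ∀ p : G.Walk x y, 5 ≤ p.length) :
    ∃ (c : G.Coloring (Fin (d + 1))) (D : Finset V),
      (∀ v ∈ D, IsDominant c v) ∧ Set.InjOn c (D : Set V) ∧ #D = d / 2 + 4 := by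
  classical
  have hxy : x ≠ y := by
    rintro rfl
    simpa using hdist Walk.nil
  have hd1 : ¬ G.Adj x y := fun h => by simpa using hdist h.toWalk
  have hd2 : ∀ {a}, G.Adj x a → ¬ G.Adj a y := fun h h' => by
    simpa using hdist (.cons h (.cons h' .nil))
  have hd3 : ∀ {a b}, G.Adj x a → G.Adj a b → ¬ G.Adj b y := fun h h' h'' => by
    simpa using hdist (.cons h (.cons h' (.cons h'' .nil)))
  have hd4 : ∀ {a b c}, G.Adj x a → G.Adj a b → G.Adj b c → ¬ G.Adj c y :=
    fun h h' h'' h''' => by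
      simpa using hdist (.cons h (.cons h' (.cons h'' (.cons h''' .nil))))
  set N : V → Finset V := fun v => G.neighborFinset v with hN
  have mem_N : ∀ {v w}, w ∈ N v ↔ G.Adj v w := fun {v w} => mem_neighborFinset ..
  have card_N : ∀ v, #(N v) = d := fun v => by
    rw [hN, card_neighborFinset_eq_degree, hreg v]
  set U := N x ∪ N y with hU_def
  have mem_U : ∀ {v}, v ∈ U ↔ G.Adj x v ∨ G.Adj y v := by
    intro v
    rw [hU_def, mem_union, mem_N, mem_N]
  set S : V → Finset V := fun u => N u \ {x, y} with hS_def
  have mem_S : ∀ {u z}, z ∈ S u ↔ G.Adj u z ∧ z ≠ x ∧ z ≠ y := by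
    intro u z
    simp [hS_def, mem_N]
  -- For `u ∈ U` this is the one vertex among `x` and `y` adjacent to `u`.
  set ctr : V → V := fun u => if G.Adj x u then x else y with hctr
  have hctr_adj : ∀ {u}, u ∈ U → G.Adj u (ctr u) := by
    intro u hu
    rcases mem_U.1 hu with h | h
    · simp [hctr, h, h.symm]
    · have : ¬ G.Adj x u := fun h' => hd2 h' h.symm
      simp [hctr, this, h.symm]
  have hctr_mem : ∀ u, ctr u = x ∨ ctr u = y := by
    intro u
    by_cases h : G.Adj x u <;> simp [hctr, h]
  have hctr_S : ∀ {u v}, u ∈ U → G.Adj u v → v = ctr u ∨ v ∈ S u := by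
    intro u v hu huv
    by_contra! hcon
    rw [mem_S] at hcon
    have h : v = x ∨ v = y := by
      by_contra! h
      exact hcon.2 ⟨huv, h⟩
    have hc := hctr_adj hu
    rcases h with rfl | rfl <;> rcases hctr_mem u with h' | h' <;> rw [h'] at hc hcon
    · exact hcon.1 rfl
    · exact hd2 huv.symm hc
    · exact hd2 hc.symm huv
    · exact hcon.1 rfl
  have hUU : ∀ {u v}, u ∈ U → v ∈ U → ¬ G.Adj u v := by
    intro u v hu hv huv
    rcases mem_U.1 hu with h | h <;> rcases mem_U.1 hv with h' | h'
    · exact htri h huv h'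
    · exact hd3 h huv h'.symm
    · exact hd3 h' huv.symm h.symm
    · exact htri h huv h'
  have hSU : ∀ {u z}, u ∈ U → z ∈ S u → z ∉ U := fun hu hz hzU =>
    hUU hu hzU (mem_S.1 hz).1
  have hcommon : ∀ {u v z}, u ∈ U → v ∈ U → G.Adj u z → G.Adj v z → z ≠ x → z ≠ y → u = v := by
    intro u v z hu hv huz hvz hzx hzy
    by_contra huv
    rcases mem_U.1 hu with h | h <;> rcases mem_U.1 hv with h' | h'
    · exact hzx (hquad huv huz hvz h.symm h'.symm)
    · exact hd4 h huz hvz.symm h'.symm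
    · exact hd4 h' hvz huz.symm h.symm
    · exact hzy (hquad huv huz hvz h.symm h'.symm)
  have hfam : IsMatchedFamily G U S (d - 1) := by
    refine ⟨fun u hu => ?_, fun u hu v hv huv => ?_, fun u hu v hv huv z hz w hw w' hw' h h' => ?_⟩
    · have : S u = (N u).erase (ctr u) := by
        ext z
        rw [mem_erase, mem_N]
        constructor
        · intro hz
          refine ⟨?_, (mem_S.1 hz).1⟩
          rcases hctr_mem u with h | h <;> rw [h]
          · exact (mem_S.1 hz).2.1
          · exact (mem_S.1 hz).2.2
        · exact fun ⟨h1, h2⟩ => (hctr_S hu h2).resolve_left h1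
      rw [this, card_erase_of_mem (mem_N.2 (hctr_adj hu)), card_N]
    · refine Finset.disjoint_left.2 fun z hz hz' => huv ?_
      obtain ⟨h1, h2, h3⟩ := mem_S.1 hz
      exact hcommon hu hv h1 (mem_S.1 hz').1 h2 h3
    · exact hquad (fun hzv : z = v => hSU hu hz (hzv ▸ hv)) h (mem_S.1 hw).1 h' (mem_S.1 hw').1
  have hUcard : #U = 2 * (d - 1 + 1) := by
    rw [hU_def, card_union_of_disjoint, card_N, card_N]
    · omega
    · exact Finset.disjoint_left.2 fun z hz hz' => hd2 (mem_N.1 hz) (mem_N.1 hz').symm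
  have hdeg : ∀ u ∈ U, ∀ z ∈ S u, setDegree G S (U.erase u) z ≤ d - 1 := by
    intro u hu z hz
    -- One of the `d` neighbors of `z` is `u`, which lies in none of the sets; the others lie in at
    -- most one set each.
    have hzu := mem_N.2 (mem_S.1 hz).1.symm
    rw [← card_N z, ← card_erase_of_mem hzu]
    have hex : ∀ v ∈ {v ∈ U.erase u | ∃ w ∈ S v, G.Adj z w}, ∃ w ∈ S v, G.Adj z w :=
      fun v hv => (mem_filter.1 hv).2
    have : Nonempty V := ⟨x⟩
    choose! f hf hf' using hex
    have hmem : ∀ {v}, v ∈ {v ∈ U.erase u | ∃ w ∈ S v, G.Adj z w} → v ∈ U := fun hv =>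
      mem_of_mem_erase (mem_filter.1 hv).1
    refine card_le_card_of_injOn f (fun v hv => ?_) fun v hv v' hv' h => ?_
    · refine mem_coe.2 (mem_erase.2 ⟨fun h => ?_, mem_N.2 (hf' v hv)⟩)
      exact hSU (hmem hv) (hf v hv) (h ▸ hu)
    · obtain ⟨h1, h2, h3⟩ := mem_S.1 (hf v hv)
      exact hcommon (hmem hv) (hmem hv') h1 (h ▸ (mem_S.1 (hf v' hv')).1) h2 h3
  -- It matters that `I` works for all palettes: the palettes come from `c₀`, which is built after
  -- `I` so that the vertices of `I` get distinct colors.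
  obtain ⟨I, hIU, hI, hcol⟩ := hfam.exists_colorable_subset (by omega) hUcard hdeg
  have hxI : x ∉ I := fun h => by
    rcases mem_U.1 (hIU h) with h | h
    · exact h.ne rfl
    · exact hd1 h.symm
  have hyI : y ∉ I := fun h => by
    rcases mem_U.1 (hIU h) with h | h
    · exact hd1 h
    · exact h.ne rfl
  set D := insert x (insert y I) with hD
  have hDcard : #D = d / 2 + 4 := by
    rw [hD, card_insert_of_notMem (by simp [hxy, hxI]), card_insert_of_notMem hyI, hI]
    omega
  -- the colors of the balls of radius `1` around `x` and `y`
  obtain ⟨g, hg, -⟩ := exists_injOn_extending (α := Fin (d + 1)) (empty_subset D)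
    (by rw [hDcard, Fintype.card_fin]; omega) (g := fun _ => 0) (by simp)
  have hball : ∀ v, #(insert v (N v)) ≤ Fintype.card (Fin (d + 1)) := fun v => by
    rw [card_insert_of_notMem (by simp [mem_N]), card_N, Fintype.card_fin]
  obtain ⟨gx, hgx, hgx'⟩ := exists_injOn_extending (s := D ∩ insert x (N x)) inter_subset_right
    (hball x) (hg.mono (by simp))
  obtain ⟨gy, hgy, hgy'⟩ := exists_injOn_extending (s := D ∩ insert y (N y)) inter_subset_right
    (hball y) (hg.mono (by simp))
  have hballs : ∀ v ∈ insert y (N y), v ∉ insert x (N x) := by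
    intro v hv hv'
    rw [mem_insert, mem_N] at hv hv'
    rcases hv with rfl | hv <;> rcases hv' with rfl | hv'
    · exact hxy rfl
    · exact hd1 hv'
    · exact hd1 hv.symm
    · exact hd2 hv' hv.symm
  set c₀ : V → Fin (d + 1) := fun v => if v ∈ insert x (N x) then gx v else gy v with hc₀
  have hc₀x : Set.InjOn c₀ (insert x (N x) : Finset V) :=
    hgx.congr fun v hv => (if_pos hv).symm
  have hc₀y : Set.InjOn c₀ (insert y (N y) : Finset V) :=
    hgy.congr fun v hv => (if_neg (hballs v hv)).symm
  have hc₀D : ∀ v ∈ D, c₀ v = g v := by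
    intro v hv
    by_cases hvx : v ∈ insert x (N x)
    · rw [← hgx' v (mem_inter.2 ⟨hv, hvx⟩)]
      exact if_pos hvx
    · rw [← hgy' v (mem_inter.2 ⟨hv, ?_⟩)]
      · exact if_neg hvx
      · rw [hD, mem_insert, mem_insert] at hv
        rcases hv with rfl | rfl | hv
        · simp at hvx
        · exact mem_insert_self _ _
        · rcases mem_union.1 (hIU hv) with h | h
          · exact absurd (mem_insert_of_mem h) hvx
          · exact mem_insert_of_mem h
  set B := insert x (N x) ∪ insert y (N y) with hB
  have mem_B : ∀ {v}, v ∈ B ↔ v = x ∨ v = y ∨ v ∈ U := by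
    intro v
    rw [hB, mem_union, mem_insert, mem_insert, hU_def, mem_union]
    tauto
  have hc₀B : ∀ v ∈ B, ∀ w ∈ B, G.Adj v w → c₀ v ≠ c₀ w := by
    intro v hv w hw hvw h
    have hcross : ∀ a ∈ insert x (N x), ∀ b ∈ insert y (N y), ¬ G.Adj a b := by
      intro a ha b hb hab
      rw [mem_insert, mem_N] at ha hb
      rcases ha with rfl | ha <;> rcases hb with rfl | hb
      · exact hd1 hab
      · exact hd2 hab hb.symm
      · exact hd2 ha hab
      · exact hd3 ha hab hb.symm
    rcases mem_union.1 hv with hv | hv <;> rcases mem_union.1 hw with hw | hw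
    · exact hvw.ne (hc₀x hv hw h)
    · exact hcross v hv w hw hvw
    · exact hcross w hw v hv hvw.symm
    · exact hvw.ne (hc₀y hv hw h)
  have hctrB : ∀ u, ctr u ∈ B := fun u => mem_B.2 (by have := hctr_mem u; tauto)
  have hUB : ∀ {u}, u ∈ U → u ∈ B := fun hu => mem_B.2 (by tauto)
  -- Omitting the colors of `u` and of its center leaves `d - 1` colors for `S u` and makes the
  -- closed neighborhood of `u` rainbow.
  obtain ⟨c₁, hc₁⟩ := hcol (α := Fin (d + 1)) (fun u => univ \ {c₀ u, c₀ (ctr u)}) (by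
    intro u hu
    have hne := hc₀B u (hUB (hIU hu)) (ctr u) (hctrB u) (hctr_adj (hIU hu))
    rw [card_univ_sdiff, Fintype.card_fin, card_pair hne]
    omega)
  have hSB : ∀ {u z}, u ∈ U → z ∈ S u → z ∉ B := fun hu hz hzB => by
    obtain ⟨-, h2, h3⟩ := mem_S.1 hz
    rcases mem_B.1 hzB with h | h | h
    · exact h2 h
    · exact h3 h
    · exact hSU hu hz h
  have hpal : ∀ u ∈ I, ∀ z ∈ S u, c₁ z ≠ c₀ u ∧ c₁ z ≠ c₀ (ctr u) := by
    intro u hu z hz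
    have := hc₁.mem u hu z hz
    simpa using this
  -- the partial coloring
  set c : V → Fin (d + 1) := fun v => if v ∈ B then c₀ v else c₁ v with hc
  have hcB : ∀ {v}, v ∈ B → c v = c₀ v := fun hv => if_pos hv
  have hcS : ∀ {u z}, u ∈ I → z ∈ S u → c z = c₁ z := fun hu hz => if_neg (hSB (hIU hu) hz)
  have hBS : ∀ u ∈ I, ∀ z ∈ S u, ∀ v ∈ B, G.Adj z v → c z ≠ c v := by
    intro u hu z hz v hv hzv
    obtain ⟨h1, h2, h3⟩ := mem_S.1 hz
    have hzU := hSU (hIU hu) hz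
    rw [mem_U, not_or] at hzU
    rcases mem_B.1 hv with rfl | rfl | hvU
    · exact absurd hzv.symm hzU.1
    · exact absurd hzv.symm hzU.2
    · obtain rfl := hcommon (hIU hu) hvU h1 hzv.symm h2 h3
      rw [hcS hu hz, hcB hv]
      exact (hpal u hu z hz).1
  set W : Set V := B ∪ {z | ∃ u ∈ I, z ∈ S u} with hW
  obtain ⟨c', hc'⟩ := exists_coloring_extending hreg W c (by
    rintro v (hv | ⟨u, hu, hv⟩) w (hw | ⟨u', hu', hw⟩) hvw
    · rw [hcB hv, hcB hw]
      exact hc₀B v hv w hw hvw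
    · exact (hBS u' hu' w hw v hv hvw.symm).symm
    · exact hBS u hu v hv w hw hvw
    · rw [hcS hu hv, hcS hu' hw]
      by_cases huu : u = u'
      · subst huu
        exact absurd (mem_S.1 hw).1 (htri (mem_S.1 hv).1 hvw)
      · exact hc₁.proper u hu u' hu' huu v hv w hw hvw)
  have hc'B : ∀ {v}, v ∈ B → c' v = c₀ v := fun hv => by rw [hc' _ (Or.inl hv), hcB hv]
  have hc'S : ∀ {u z}, u ∈ I → z ∈ S u → c' z = c₁ z := fun hu hz => by
    rw [hc' _ (Or.inr ⟨_, hu, hz⟩), hcS hu hz]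
  have hDB : ∀ {v}, v ∈ D → v ∈ B := by
    intro v hv
    rw [hD, mem_insert, mem_insert] at hv
    rcases hv with h | h | h
    · exact mem_B.2 (Or.inl h)
    · exact mem_B.2 (Or.inr (Or.inl h))
    · exact hUB (hIU h)
  refine ⟨c', D, fun v hv => isDominant_of_injOn hreg c' ?_, ?_, hDcard⟩
  · rw [hD, mem_insert, mem_insert] at hv
    rcases hv with rfl | rfl | hv
    · exact hc₀x.congr fun w hw => (hc'B (mem_union_left _ hw)).symm
    · exact hc₀y.congr fun w hw => (hc'B (mem_union_right _ hw)).symm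
    · have hnbr : ∀ w ∈ N v, ∀ w' ∈ N v, c' w = c' w' → w = w' := by
        intro w hw w' hw' h
        rw [mem_N] at hw hw'
        rcases hctr_S (hIU hv) hw with h1 | h1 <;> rcases hctr_S (hIU hv) hw' with h2 | h2
        · rw [h1, h2]
        · rw [h1, hc'B (hctrB v), hc'S hv h2] at h
          exact absurd h.symm (hpal v hv w' h2).2
        · rw [h2, hc'B (hctrB v), hc'S hv h1] at h
          exact absurd h (hpal v hv w h1).2
        · rw [hc'S hv h1, hc'S hv h2] at h
          exact hc₁.inj v hv h1 h2 h
      intro w hw w' hw' h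
      rcases mem_insert.1 (mem_coe.1 hw) with h1 | h1 <;>
        rcases mem_insert.1 (mem_coe.1 hw') with h2 | h2
      · rw [h1, h2]
      · exact absurd (h1 ▸ h) (c'.valid (mem_N.1 h2))
      · exact absurd (h2 ▸ h.symm) (c'.valid (mem_N.1 h1))
      · exact hnbr w h1 w' h2 h
  · exact hg.congr fun v hv => by rw [hc'B (hDB hv), hc₀D v hv]

end

end SimpleGraph

/-! ### The main theorem -/

theorem theorem3p1 {V : Type*} (G : SimpleGraph V) [G.LocallyFinite] (d : ℕ) (hd : 7 ≤ d)
    (hreg : G.IsRegularOfDegree d) (hgirth : G.girth = 5) (hdiam : G.diam = 5) :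
    ⌈((d : ℝ) - 1) / 2⌉₊ + 4 ≤ G.fChromaticVertexNumber d ∧
      ⌈((d : ℝ) - 1) / 2⌉₊ + 4 ≤ G.bChromaticNumber := by
  have hceil : ⌈((d : ℝ) - 1) / 2⌉₊ ≤ d / 2 := by
    rw [Nat.ceil_le, div_le_iff₀ two_pos, sub_le_iff_le_add]
    have : d ≤ d / 2 * 2 + 1 := by omega
    exact_mod_cast this
  have hdiam0 : G.diam ≠ 0 := by omega
  have := SimpleGraph.finite_of_diam_ne_zero hdiam0
  have := SimpleGraph.nontrivial_of_diam_ne_zero hdiam0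
  obtain ⟨x, y, hxy⟩ := G.exists_dist_eq_diam
  obtain ⟨c, D, hD, hinj, hcard⟩ := SimpleGraph.exists_coloring_dominant (x := x) (y := y) (by omega) hreg
    (fun h h' => SimpleGraph.not_adj_of_three_lt_girth (by omega) h h')
    (fun h => SimpleGraph.eq_of_adj_of_four_lt_girth (by omega) h)
    (fun p => by have := SimpleGraph.dist_le p; omega)
  constructor
  · exact (Nat.add_le_add_right hceil 4).trans
      (le_csSup (SimpleGraph.bddAbove_card_dominant d) ⟨c, D, hD, hinj, hcard⟩)
  · obtain ⟨k, hk, hb⟩ := SimpleGraph.exists_isBColoring c D hD hinj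
    exact ((Nat.add_le_add_right hceil 4).trans (hcard ▸ hk)).trans
      (le_csSup (SimpleGraph.bddAbove_isBColoring hreg) hb)
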